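/- Let $p>3$ be a prime and let $G$ be a group of order $p^5$ in the isoclinism family $\Phi_7$ of James' classification, i.e. $|G|=p^5$ and $G$ is isoclinic to the group $$\Phi_7(1^5)=\langle \alpha,\alpha_1,\alpha_2,\alpha_3,\beta \mid [\alpha_i,\alpha]=\alpha_{i+1},\ [\alpha_1,\beta]=\alpha_3,\ \alpha^p=\alpha_1^p\alpha_2^{\binom p2}\alpha_3^{\binom p3}=\alpha_{i+1}^p=\beta^p=1\ (i=1,2)\rangle,$$ where $[x,y]=x^{-1}y^{-1}xy$ and all pairs of generators whose commutator is not listed commute. (Two groups $G,H$ are isoclinic if there are isomorphisms $G/Z(G)\to H/Z(H)$ and $[G,G]\to[H,H]$ compatible with the commutator maps.) Then $B_0(G)=0$, where $$B_0(G)=\bigcap_{A\le G,\ A\text{ abelian}}\ker\bigl(\operatorname{res}^G_A: H^2(G,\mathbb Q/\mathbb Z)\to H^2(A,\mathbb Q/\mathbb Z)\bigr)$$ is the Bogomolov multiplier of $G$ (with trivial action on $\mathbb Q/\mathbb Z$). -/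

import Mathlib

universe u v

open scoped commutatorElement

/-- Two groups are isoclinic if there are isomorphisms `G/Z(G) ≃ H/Z(H)` and `[G,G] ≃ [H,H]` that
are compatible with the commutator maps. (This does not depend on which of the two conventions for
the commutator is used, since these differ by `(x, y) ↦ (x⁻¹, y⁻¹)`.) -/
def Isoclinic (G : Type u) (H : Type v) [Group G] [Group H] : Prop :=
  ∃ (φ : (G ⧸ Subgroup.center G) ≃* (H ⧸ Subgroup.center H)) (ψ : commutator G ≃* commutator H),
    ∀ (g₁ g₂ : G) (h₁ h₂ : H),
      φ (QuotientGroup.mk g₁) = QuotientGroup.mk h₁ →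
      φ (QuotientGroup.mk g₂) = QuotientGroup.mk h₂ →
      (ψ ⟨⁅g₁, g₂⁆,
        Subgroup.commutator_mem_commutator (Subgroup.mem_top g₁) (Subgroup.mem_top g₂)⟩ : H)
        = ⁅h₁, h₂⁆

namespace PhiSeven

/-- The generators `α, α₁, α₂, α₃, β`. -/
inductive Gen : Type
  | α : Gen
  | α₁ : Gen
  | α₂ : Gen
  | α₃ : Gen
  | β : Gen

/-- The generators as elements of the free group. -/
def gen (x : Gen) : FreeGroup Gen := FreeGroup.of x

/-- The commutator `[x, y] = x⁻¹ y⁻¹ x y`. -/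
def comm {G : Type u} [Group G] (x y : G) : G := x⁻¹ * y⁻¹ * x * y

open Gen in
/-- The relators of `Φ₇(1⁵)`:
`[α₁, α] = α₂`, `[α₂, α] = α₃`, `[α₁, β] = α₃`, all the other pairs of generators commute, and
`α ^ p = α₁ ^ (p) = α₂ ^ p = α₃ ^ p = β ^ p = 1`,
where `α₁ ^ (p)` stands for `α₁ ^ p * α₂ ^ choose p 2 * α₃ ^ choose p 3`. -/
def relators (p : ℕ) : Set (FreeGroup Gen) :=
  { comm (gen α₁) (gen α) * (gen α₂)⁻¹,
    comm (gen α₂) (gen α) * (gen α₃)⁻¹,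
    comm (gen α₁) (gen β) * (gen α₃)⁻¹,
    comm (gen α₃) (gen α),
    comm (gen α) (gen β),
    comm (gen α₁) (gen α₂),
    comm (gen α₁) (gen α₃),
    comm (gen α₂) (gen α₃),
    comm (gen α₂) (gen β),
    comm (gen α₃) (gen β),
    gen α ^ p,
    gen α₁ ^ p * gen α₂ ^ p.choose 2 * gen α₃ ^ p.choose 3,
    gen α₂ ^ p,
    gen α₃ ^ p,
    gen β ^ p }

/-- The group `Φ₇(1⁵)` for the prime `p`. -/
abbrev Phi7One (p : ℕ) : Type := PresentedGroup (relators p)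

end PhiSeven

/-- `G` is a group of order `p ^ 5` in the isoclinism family `Φ₇`, the family of `Φ₇(1⁵)`. -/
def InFamilyPhi7 (p : ℕ) (G : Type u) [Group G] : Prop :=
  Nat.card G = p ^ 5 ∧ Isoclinic G (PhiSeven.Phi7One p)

/-- `ℚ/ℤ` with the trivial action of `G`; the base ring `ℤ` and `ℚ/ℤ` are lifted to the
universe of `G`. -/
noncomputable abbrev trivialQZ (G : Type u) [Group G] : Rep (ULift.{u} ℤ) G :=
  Rep.trivial (ULift.{u} ℤ) G (ULift.{u} (AddCircle (1 : ℚ)))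

/-- The restriction map `res : H²(G, ℚ/ℤ) → H²(A, ℚ/ℤ)` to a subgroup `A` of `G`. -/
noncomputable def resH2 {G : Type u} [Group G] (A : Subgroup G) :
    groupCohomology (trivialQZ G) 2 →ₗ[ULift.{u} ℤ] groupCohomology (trivialQZ A) 2 :=
  (groupCohomology.map (A := trivialQZ G) (B := trivialQZ A) A.subtype
    (CategoryTheory.CategoryStruct.id (trivialQZ A)) 2).hom

/-- The Bogomolov multiplier `B₀(G)`: the intersection, over all abelian subgroups `A` of `G`, of
the kernels of the restriction maps `H²(G, ℚ/ℤ) → H²(A, ℚ/ℤ)`. -/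
noncomputable def bogomolovMultiplier (G : Type u) [Group G] :
    Submodule (ULift.{u} ℤ) (groupCohomology (trivialQZ G) 2) :=
  ⨅ (A : Subgroup G) (_ : IsMulCommutative A), LinearMap.ker (resH2 A)

/-! ### Commutator calculus for generators of type Φ₇. -/

section Groups

variable {E : Type*} [Group E]

/-! A class in the Bogomolov multiplier is a central extension `E` of `G` by D = ℚ/ℤ whose cocycle
is symmetric on commuting pairs, so commuting elements of `G` have only commuting lifts
(`symm_of_mem_bogomolovMultiplier`, `commute_of_commute_proj`). As D is divisible, the extension
splits once D ∩ [E, E] = 1 (`exists_coboundary`).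

To see this, compose `E` → `G` with the isoclinism: pairs that commute in Φ₇(1⁵) lift to commuting
pairs of `E`. Hence lifts a, b, d of α, α₁, β satisfy the Φ₇ commutator relations in `E` itself,
with c = [b, a] and one central e = [c, a] = [b, d] (`exists_isPhi7System`). Then [E, E] = ⟨c, e⟩
has exponent dividing p. An element c^i e^j of D is central, which forces p ∣ i or e = 1; what
remains is a power of c or of e, and neither commutator can die in `G` without already being trivial
in `E` (`eq_one_of_mem_commutator`). -/

theorem eq_one_of_zpow_eq_one_of_pow_prime_eq_one {p : ℕ} (hp : p.Prime) {g : E} (hg : g ^ p = 1)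
    {i : ℤ} (hi : ¬ (p : ℤ) ∣ i) (h : g ^ i = 1) : g = 1 := by
  have h1 : (orderOf g : ℤ) ∣ i := orderOf_dvd_iff_zpow_eq_one.2 h
  rcases (Nat.dvd_prime hp).1 (orderOf_dvd_of_pow_eq_one hg) with h2 | h2
  · exact orderOf_eq_one_iff.1 h2
  · exact absurd (h2 ▸ h1) hi

theorem zpow_eq_one_of_dvd {p : ℕ} {g : E} (hg : g ^ p = 1) {i : ℤ} (hi : (p : ℤ) ∣ i) :
    g ^ i = 1 := by
  obtain ⟨k, rfl⟩ := hi
  rw [zpow_mul, zpow_natCast, hg, one_zpow]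

/-- A commutator relation with central commutator, for powers of the right factor. -/
theorem mul_pow_eq_of_mul_eq {b d e : E} (he : ∀ x, Commute e x) (h : b * d = d * b * e) (n : ℕ) :
    b * d ^ n = d ^ n * b * e ^ n := by
  induction n with
  | zero => simp
  | succ n ih =>
    calc b * d ^ (n + 1) = b * d ^ n * d := by rw [pow_succ, mul_assoc]
      _ = d ^ n * b * (e ^ n * d) := by rw [ih, mul_assoc]
      _ = d ^ n * (b * d) * e ^ n := by rw [((he d).pow_left n).eq]; simp only [mul_assoc]
      _ = d ^ (n + 1) * b * (e * e ^ n) := by rw [h, pow_succ]; simp only [mul_assoc]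
      _ = d ^ (n + 1) * b * e ^ (n + 1) := by rw [← pow_succ']

/-- Conjugation by `a` multiplies powers of `c` by a power of the central commutator. -/
theorem conj_zpow_eq_of_mul_eq {a c e : E} (he : ∀ x, Commute e x) (h : c * a = a * c * e) (i : ℤ) :
    a⁻¹ * c ^ i * a = c ^ i * e ^ i := by
  have h1 : a⁻¹ * c * a = c * e := by rw [mul_assoc, h]; group
  have h2 := conj_zpow (i := i) (a := a⁻¹) (b := c)
  rw [inv_inv] at h2
  rw [← h2, h1, (he c).symm.mul_zpow]

/-- Collection: each a passing b leaves a c, and the next a must pass all earlier c's, so the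
exponent of e is 0 + 1 + ⋯ + (n - 1). -/
theorem mul_pow_eq_of_class_three {a b c e : E} (he : ∀ x, Commute e x) (hba : b * a = a * b * c)
    (hca : c * a = a * c * e) (n : ℕ) :
    b * a ^ n = a ^ n * b * c ^ n * e ^ n.choose 2 := by
  induction n with
  | zero => simp
  | succ n ih =>
    have h1 : c ^ n * a = a * c ^ n * e ^ n := by
      have := conj_zpow_eq_of_mul_eq he hca n
      simp only [zpow_natCast] at this
      rw [mul_assoc, inv_mul_eq_iff_eq_mul] at this
      rw [this, mul_assoc]
    calc b * a ^ (n + 1) = b * a ^ n * a := by rw [pow_succ, mul_assoc]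
      _ = a ^ n * b * c ^ n * (e ^ n.choose 2 * a) := by rw [ih, mul_assoc]
      _ = a ^ n * b * (c ^ n * a) * e ^ n.choose 2 := by
        rw [((he a).pow_left _).eq]; simp only [mul_assoc]
      _ = a ^ n * (b * a) * c ^ n * (e ^ n * e ^ n.choose 2) := by
        rw [h1]; simp only [mul_assoc]
      _ = a ^ (n + 1) * b * (c * c ^ n) * (e ^ n * e ^ n.choose 2) := by
        rw [hba, pow_succ a]; simp only [mul_assoc]
      _ = a ^ (n + 1) * b * c ^ (n + 1) * e ^ (n + 1).choose 2 := by
        rw [← pow_succ', ← pow_add, Nat.choose_succ_succ' n 1, Nat.choose_one_right]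

/-- Generators of a group modulo its centre, subject to the commutator relations of `Φ₇`. -/
structure IsPhi7System (p : ℕ) (a b c d e : E) : Prop where
  central : ∀ x, Commute e x
  mul_ba : b * a = a * b * c
  mul_ca : c * a = a * c * e
  mul_bd : b * d = d * b * e
  comm_ad : Commute a d
  comm_bc : Commute b c
  comm_cd : Commute c d
  pow_a : ∀ x, Commute (a ^ p) x
  pow_d : ∀ x, Commute (d ^ p) x
  closure_eq_top : Subgroup.closure ({a, b, c, d} ∪ (Subgroup.center E : Set E)) = ⊤

namespace IsPhi7System

variable {p : ℕ} {a b c d e : E}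

/-- Moving b past the central element d ^ p costs e ^ p. -/
theorem pow_e_eq_one (h : IsPhi7System p a b c d e) : e ^ p = 1 := by
  have h1 := mul_pow_eq_of_mul_eq h.central h.mul_bd p
  rw [(h.pow_d b).eq] at h1
  exact left_eq_mul.1 h1

/-- Moving b past the central a ^ p costs c ^ p times a power of e that vanishes, since p odd gives
p ∣ p.choose 2. -/
theorem pow_c_eq_one (h : IsPhi7System p a b c d e) (hp : p.Prime) (hp2 : 2 < p) : c ^ p = 1 := by
  have h1 := mul_pow_eq_of_class_three h.central h.mul_ba h.mul_ca p
  obtain ⟨k, hk⟩ := hp.dvd_choose_self two_ne_zero hp2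
  rw [(h.pow_a b).eq, hk, pow_mul, h.pow_e_eq_one, one_pow, mul_one] at h1
  exact left_eq_mul.1 h1

theorem mem_closure_iff (h : IsPhi7System p a b c d e) {x : E} :
    x ∈ Subgroup.closure {c, e} ↔ ∃ i j : ℤ, x = c ^ i * e ^ j := by
  constructor
  · intro hx
    induction hx using Subgroup.closure_induction with
    | mem x hx =>
      rcases hx with rfl | rfl
      · exact ⟨1, 0, by simp⟩
      · exact ⟨0, 1, by simp⟩
    | one => exact ⟨0, 0, by simp⟩
    | mul x y _ _ hx hy =>
      obtain ⟨i, j, rfl⟩ := hx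
      obtain ⟨k, l, rfl⟩ := hy
      refine ⟨i + k, j + l, ?_⟩
      rw [zpow_add, zpow_add, mul_assoc, ← mul_assoc (e ^ j),
        ((h.central (c ^ k)).zpow_left j).eq]
      simp only [mul_assoc]
    | inv x _ hx =>
      obtain ⟨i, j, rfl⟩ := hx
      refine ⟨-i, -j, ?_⟩
      rw [mul_inv_rev, zpow_neg, zpow_neg, ← zpow_neg e, ((h.central _).zpow_left _).eq]
  · rintro ⟨i, j, rfl⟩
    exact mul_mem (zpow_mem (Subgroup.subset_closure (by simp)) _)
      (zpow_mem (Subgroup.subset_closure (by simp)) _)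

theorem normal_closure (h : IsPhi7System p a b c d e) :
    (Subgroup.closure {c, e}).Normal := by
  rw [← Subgroup.normalizer_eq_top_iff, eq_top_iff, ← h.closure_eq_top, Subgroup.closure_le]
  have key : ∀ g : E, (∃ k : ℤ, ∀ i : ℤ, g⁻¹ * c ^ i * g = c ^ i * e ^ (k * i)) →
      g ∈ Subgroup.normalizer (Subgroup.closure {c, e} : Set E) := by
    rintro g ⟨k, hg⟩
    have hconj : ∀ i j : ℤ, g⁻¹ * (c ^ i * e ^ j) * g = c ^ i * e ^ (k * i + j) := by
      intro i j
      rw [zpow_add, ← mul_assoc (c ^ i), ← hg]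
      simp only [mul_assoc, ((h.central g).zpow_left j).eq]
    refine Subgroup.mem_normalizer_iff''.2 fun x => ⟨fun hx => ?_, fun hx => ?_⟩
    · obtain ⟨i, j, rfl⟩ := h.mem_closure_iff.1 hx
      exact h.mem_closure_iff.2 ⟨_, _, hconj i j⟩
    · obtain ⟨i, j, hij⟩ := h.mem_closure_iff.1 hx
      refine h.mem_closure_iff.2 ⟨i, j - k * i, ?_⟩
      rw [← mul_left_inj g, ← mul_right_inj g⁻¹, ← mul_assoc, ← mul_assoc, hij, hconj]
      simp
  have key' : ∀ g : E, Commute g c →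
      g ∈ Subgroup.normalizer (Subgroup.closure {c, e} : Set E) := fun g hg =>
    key g ⟨0, fun i => by
      rw [mul_assoc, ← (hg.zpow_right i).eq, inv_mul_cancel_left, zero_mul, zpow_zero, mul_one]⟩
  rintro g ((rfl | rfl | rfl | rfl) | hg)
  · exact key _ ⟨1, fun i => by rw [one_mul, conj_zpow_eq_of_mul_eq h.central h.mul_ca]⟩
  · exact key' _ h.comm_bc
  · exact key' _ (Commute.refl _)
  · exact key' _ h.comm_cd.symm
  · exact key' _ (Subgroup.mem_center_iff.1 hg c).symm

/-- Modulo ⟨c, e⟩ the generators a, b, d commute pairwise, so the quotient is abelian. -/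
theorem commutator_le (h : IsPhi7System p a b c d e) :
    commutator E ≤ Subgroup.closure {c, e} := by
  have := h.normal_closure
  rw [← Subgroup.Normal.quotient_commutative_iff_commutator_le]
  set N := Subgroup.closure {c, e}
  have hc : (c : E ⧸ N) = 1 := (QuotientGroup.eq_one_iff c).2 (Subgroup.subset_closure (by simp))
  have he : (e : E ⧸ N) = 1 := (QuotientGroup.eq_one_iff e).2 (Subgroup.subset_closure (by simp))
  have hab : Commute (a : E ⧸ N) b := by
    have := congrArg (QuotientGroup.mk (s := N)) h.mul_ba
    simp only [QuotientGroup.mk_mul, hc, mul_one] at this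
    exact this.symm
  have hbd : Commute (b : E ⧸ N) d := by
    have := congrArg (QuotientGroup.mk (s := N)) h.mul_bd
    rwa [QuotientGroup.mk_mul, QuotientGroup.mk_mul, he, mul_one, QuotientGroup.mk_mul] at this
  have had : Commute (a : E ⧸ N) d := h.comm_ad.map (QuotientGroup.mk' N)
  have hz : ∀ z ∈ Subgroup.center E, ∀ x : E ⧸ N, Commute (z : E ⧸ N) x := by
    intro z hz x
    obtain ⟨x, rfl⟩ := QuotientGroup.mk_surjective x
    exact Commute.map (Subgroup.mem_center_iff.1 hz x).symm (QuotientGroup.mk' N)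
  have htop : Subgroup.closure
      (QuotientGroup.mk' N '' ({a, b, c, d} ∪ (Subgroup.center E : Set E))) = ⊤ := by
    rw [← MonoidHom.map_closure, h.closure_eq_top, ← MonoidHom.range_eq_map,
      MonoidHom.range_eq_top.2 (QuotientGroup.mk'_surjective N)]
  have hcomm := Subgroup.isMulCommutative_closure
    (k := QuotientGroup.mk' N '' ({a, b, c, d} ∪ (Subgroup.center E : Set E))) (by
      rintro _ ⟨x, hx, rfl⟩ _ ⟨y, hy, rfl⟩
      change Commute (x : E ⧸ N) (y : E ⧸ N)
      simp only [Set.mem_union, Set.mem_insert_iff, Set.mem_singleton_iff, SetLike.mem_coe] at hx hy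
      rcases hy with hy | hy
      swap
      · exact (hz y hy _).symm
      rcases hx with hx | hx
      swap
      · exact hz x hx _
      rcases hx with rfl | rfl | rfl | rfl <;> rcases hy with rfl | rfl | rfl | rfl <;>
        first
          | exact Commute.refl _
          | assumption
          | (apply Commute.symm; assumption)
          | (rw [hc]; exact Commute.one_right _)
          | (rw [hc]; exact Commute.one_left _))
  rw [htop] at hcomm
  exact ⟨⟨fun x y => congrArg Subtype.val
    (hcomm.is_comm.comm (⟨x, Subgroup.mem_top x⟩ : (⊤ : Subgroup (E ⧸ N))) ⟨y, Subgroup.mem_top y⟩)⟩⟩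

/-- A homomorphism that reflects commutation is injective on the commutator subgroup. -/
theorem eq_one_of_mem_commutator {G : Type*} [Group G] (h : IsPhi7System p a b c d e)
    (hp : p.Prime) (hp2 : 2 < p) (π : E →* G)
    (hπ : ∀ x y, Commute (π x) (π y) → Commute x y) {x : E} (hx : x ∈ commutator E)
    (hx1 : π x = 1) : x = 1 := by
  have hcp := h.pow_c_eq_one hp hp2
  have hep := h.pow_e_eq_one
  obtain ⟨i, j, rfl⟩ := h.mem_closure_iff.1 (h.commutator_le hx)
  -- An element of the kernel of `π` is central, because 1 commutes with everything in `G`.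
  have hcomm : Commute (c ^ i * e ^ j) a := hπ _ _ (by rw [hx1]; exact Commute.one_left _)
  have he : π e = 1 → e = 1 := by
    intro h1
    have h2 : Commute c a := hπ _ _ <| by
      have := congrArg π h.mul_ca
      rwa [map_mul, map_mul, h1, mul_one, map_mul] at this
    have h3 := h.mul_ca
    rw [h2.eq] at h3
    exact left_eq_mul.1 h3
  have hc : π c = 1 → c = 1 := by
    intro h1
    have h2 : Commute b a := hπ _ _ <| by
      have := congrArg π h.mul_ba
      rwa [map_mul, map_mul, h1, mul_one, map_mul] at this
    have h3 := h.mul_ba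
    rw [h2.eq] at h3
    exact left_eq_mul.1 h3
  by_cases hi : (p : ℤ) ∣ i
  · rw [zpow_eq_one_of_dvd hcp hi, one_mul] at hx1 ⊢
    by_cases hj : (p : ℤ) ∣ j
    · exact zpow_eq_one_of_dvd hep hj
    · rw [map_zpow] at hx1
      rw [he (eq_one_of_zpow_eq_one_of_pow_prime_eq_one hp
        (by rw [← map_pow, hep, map_one]) hj hx1), one_zpow]
  -- Conjugating c ^ i by a multiplies it by e ^ i, yet it commutes with a.
  · have h1 : e ^ i = 1 := by
      have h2 := conj_zpow_eq_of_mul_eq h.central h.mul_ca i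
      have h3 : Commute (c ^ i) a := by
        have := hcomm.mul_left ((h.central a).zpow_left (-j))
        rwa [mul_assoc, ← zpow_add, add_neg_cancel, zpow_zero, mul_one] at this
      rw [mul_assoc, h3.eq, inv_mul_cancel_left] at h2
      exact left_eq_mul.1 h2
    have he1 := eq_one_of_zpow_eq_one_of_pow_prime_eq_one hp hep hi h1
    rw [he1, one_zpow, mul_one] at hx1 ⊢
    rw [map_zpow] at hx1
    rw [hc (eq_one_of_zpow_eq_one_of_pow_prime_eq_one hp
        (by rw [← map_pow, hcp, map_one]) hi hx1), one_zpow]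

end IsPhi7System

end Groups

/-! ### Relations in Φ₇(1⁵) and their transfer along the isoclinism. -/

namespace PhiSeven

variable {p : ℕ}

/-- The generators as elements of `Φ₇(1⁵)`. -/
abbrev ofGen (p : ℕ) (x : Gen) : Phi7One p := PresentedGroup.of x

theorem comm_eq_of_mem {x y z : Gen} (h : comm (gen x) (gen y) * (gen z)⁻¹ ∈ relators p) :
    ofGen p x * ofGen p y = ofGen p y * ofGen p x * ofGen p z := by
  have h1 : (ofGen p x)⁻¹ * (ofGen p y)⁻¹ * ofGen p x * ofGen p y * (ofGen p z)⁻¹ = 1 :=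
    PresentedGroup.one_of_mem h
  rw [mul_inv_eq_one] at h1
  rw [← h1]
  group

theorem commute_of_mem {x y : Gen} (h : comm (gen x) (gen y) ∈ relators p) :
    Commute (ofGen p x) (ofGen p y) := by
  have h1 : (ofGen p x)⁻¹ * (ofGen p y)⁻¹ * ofGen p x * ofGen p y = 1 :=
    PresentedGroup.one_of_mem h
  have h2 : ofGen p x * ofGen p y = ofGen p y * ofGen p x *
      ((ofGen p x)⁻¹ * (ofGen p y)⁻¹ * ofGen p x * ofGen p y) := by group
  rwa [h1, mul_one] at h2

theorem pow_eq_one_of_mem {x : Gen} (h : gen x ^ p ∈ relators p) : ofGen p x ^ p = 1 :=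
  PresentedGroup.one_of_mem h

theorem commute_α₃ (y : Phi7One p) : Commute (ofGen p .α₃) y := by
  have h : y ∈ Subgroup.centralizer {ofGen p .α₃} := by
    have h1 : (⊤ : Subgroup (Phi7One p)) ≤ Subgroup.centralizer {ofGen p .α₃} := by
      rw [← PresentedGroup.closure_range_of, Subgroup.closure_le]
      rintro _ ⟨g, rfl⟩
      rw [SetLike.mem_coe, Subgroup.mem_centralizer_singleton_iff]
      cases g
      · exact (commute_of_mem (x := .α₃) (y := .α) (by simp [relators])).symm
      · exact commute_of_mem (x := .α₁) (y := .α₃) (by simp [relators])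
      · exact commute_of_mem (x := .α₂) (y := .α₃) (by simp [relators])
      · rfl
      · exact (commute_of_mem (x := .α₃) (y := .β) (by simp [relators])).symm
    exact h1 (Subgroup.mem_top y)
  exact (Subgroup.mem_centralizer_singleton_iff.1 h).symm

end PhiSeven

/-- If `π : E → G` is surjective and commuting elements of `G` have only commuting lifts, then
an isoclinism from `G` to `H` presents `H/Z(H)` as a quotient of `E` in such a way that elements of
`E` commute as soon as the corresponding elements of `H` do. -/
theorem Isoclinic.exists_lift {G H E : Type*} [Group G] [Group H] [Group E] (h : Isoclinic G H)
    (π : E →* G) (hsurj : Function.Surjective π)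
    (hπ : ∀ x y, Commute (π x) (π y) → Commute x y) :
    ∃ θ : E →* H ⧸ Subgroup.center H, Function.Surjective θ ∧ ∀ (x y : E) (u v : H),
      θ x = QuotientGroup.mk u → θ y = QuotientGroup.mk v → Commute u v → Commute x y := by
  obtain ⟨φ, ψ, hφ⟩ := h
  refine ⟨(φ.toMonoidHom.comp (QuotientGroup.mk' _)).comp π, ?_, ?_⟩
  · exact (φ.surjective.comp (QuotientGroup.mk'_surjective _)).comp hsurj
  · intro x y u v hx hy huv
    apply hπ
    have h1 := hφ (π x) (π y) u v hx hy
    rw [commutatorElement_eq_one_iff_commute.2 huv, OneMemClass.coe_eq_one,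
      EmbeddingLike.map_eq_one_iff] at h1
    exact commutatorElement_eq_one_iff_commute.1 (congrArg Subtype.val h1)

open PhiSeven in
-- Only commutation transfers from Φ₇(1⁵), so c, e and f are defined as commutators in `E`, and
-- every relation has to be read off from some commuting pair.
theorem exists_isPhi7System {p : ℕ} {G E : Type*} [Group G] [Group E]
    (h : Isoclinic G (Phi7One p)) (π : E →* G) (hsurj : Function.Surjective π)
    (hπ : ∀ x y, Commute (π x) (π y) → Commute x y) :
    ∃ a b c d e : E, IsPhi7System p a b c d e := by
  obtain ⟨θ, hθ, hcomm⟩ := h.exists_lift π hsurj hπ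
  let q : Phi7One p →* Phi7One p ⧸ Subgroup.center (Phi7One p) := QuotientGroup.mk' _
  have hcentral : ∀ x z, (∀ y, Commute z y) → θ x = q z → ∀ y, Commute x y := by
    intro x z hz hx y
    obtain ⟨v, hv⟩ := QuotientGroup.mk_surjective (θ y)
    exact hcomm x y z v hx hv.symm (hz v)
  obtain ⟨a, ha⟩ := hθ (q (ofGen p .α))
  obtain ⟨b, hb⟩ := hθ (q (ofGen p .α₁))
  obtain ⟨d, hd⟩ := hθ (q (ofGen p .β))
  have hα : ofGen p .α₁ * ofGen p .α = ofGen p .α * ofGen p .α₁ * ofGen p .α₂ :=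
    comm_eq_of_mem (by simp [relators])
  have hα₂ : ofGen p .α₂ * ofGen p .α = ofGen p .α * ofGen p .α₂ * ofGen p .α₃ :=
    comm_eq_of_mem (by simp [relators])
  have hβ : ofGen p .α₁ * ofGen p .β = ofGen p .β * ofGen p .α₁ * ofGen p .α₃ :=
    comm_eq_of_mem (by simp [relators])
  have hαβ : Commute (ofGen p .α) (ofGen p .β) := commute_of_mem (by simp [relators])
  have h12 : Commute (ofGen p .α₁) (ofGen p .α₂) := commute_of_mem (by simp [relators])
  have h2β : Commute (ofGen p .α₂) (ofGen p .β) := commute_of_mem (by simp [relators])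
  obtain ⟨c, hc⟩ : ∃ c, b * a = a * b * c := ⟨(a * b)⁻¹ * (b * a), by group⟩
  obtain ⟨e, he⟩ : ∃ e, c * a = a * c * e := ⟨(a * c)⁻¹ * (c * a), by group⟩
  obtain ⟨f, hf⟩ : ∃ f, b * d = d * b * f := ⟨(d * b)⁻¹ * (b * d), by group⟩
  have hc' : θ c = q (ofGen p .α₂) := by
    have h1 := congrArg θ hc
    rw [map_mul, map_mul, map_mul, ha, hb, ← map_mul, ← map_mul, hα, map_mul q] at h1
    exact (mul_left_cancel h1).symm
  have he' : θ e = q (ofGen p .α₃) := by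
    have h1 := congrArg θ he
    rw [map_mul, map_mul, map_mul, ha, hc', ← map_mul, ← map_mul, hα₂, map_mul q] at h1
    exact (mul_left_cancel h1).symm
  have hf' : θ f = q (ofGen p .α₃) := by
    have h1 := congrArg θ hf
    rw [map_mul, map_mul, map_mul, hb, hd, ← map_mul, ← map_mul, hβ, map_mul q] at h1
    exact (mul_left_cancel h1).symm
  have hez := hcentral e _ commute_α₃ he'
  have hfz := hcentral f _ commute_α₃ hf'
  have had : Commute a d := hcomm _ _ _ _ ha hd hαβ
  have hcd : Commute c d := hcomm _ _ _ _ hc' hd h2β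
  have hbc : Commute b c := hcomm _ _ _ _ hb hc' h12
  -- The commutators `[c, a]` and `[b, d]` agree because `c * d` and `a * b` commute.
  have hef : e = f := by
    have h1 : Commute (ofGen p .α₂ * ofGen p .β) (ofGen p .α * ofGen p .α₁) :=
      calc ofGen p .α₂ * ofGen p .β * (ofGen p .α * ofGen p .α₁)
          = ofGen p .α₂ * (ofGen p .α * ofGen p .β) * ofGen p .α₁ := by
            rw [hαβ.eq]; simp only [mul_assoc]
        _ = ofGen p .α * ofGen p .α₂ * (ofGen p .α₃ * (ofGen p .β * ofGen p .α₁)) := by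
            rw [← mul_assoc, hα₂]; simp only [mul_assoc]
        _ = ofGen p .α * (ofGen p .α₂ * ofGen p .α₁) * ofGen p .β := by
            rw [(commute_α₃ _).eq, ← hβ]; simp only [mul_assoc]
        _ = ofGen p .α * ofGen p .α₁ * (ofGen p .α₂ * ofGen p .β) := by
            rw [← h12.eq]; simp only [mul_assoc]
    have h2 : Commute (c * d) (a * b) := hcomm _ _ _ _
      (by rw [map_mul, hc', hd]; rfl) (by rw [map_mul, ha, hb]; rfl) h1
    have h3 : c * d * (a * b) = a * b * (c * d) * f⁻¹ * e :=
      calc c * d * (a * b) = c * a * (d * b) := by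
            rw [mul_assoc, ← mul_assoc d, ← had.eq]; simp only [mul_assoc]
        _ = a * c * (e * (b * d)) * f⁻¹ := by
            rw [he, hf]; simp only [mul_assoc, mul_inv_cancel, mul_one]
        _ = a * (c * b) * d * e * f⁻¹ := by rw [(hez _).eq]; simp only [mul_assoc]
        _ = a * b * (c * d) * (e * f⁻¹) := by rw [← hbc.eq]; simp only [mul_assoc]
        _ = a * b * (c * d) * f⁻¹ * e := by rw [(hez _).eq]; simp only [mul_assoc]
    rw [h2.eq, mul_assoc _ f⁻¹] at h3
    exact (inv_mul_eq_one.1 (left_eq_mul.1 h3)).symm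
  refine ⟨a, b, c, d, e, hez, hc, he, hef ▸ hf, had, hbc, hcd, ?_, ?_, ?_⟩
  · refine hcentral _ 1 (fun _ => Commute.one_left _) ?_
    rw [map_pow, ha, ← map_pow, pow_eq_one_of_mem (by simp [relators])]
  · refine hcentral _ 1 (fun _ => Commute.one_left _) ?_
    rw [map_pow, hd, ← map_pow, pow_eq_one_of_mem (by simp [relators])]
  · set S : Set E := {a, b, c, d} ∪ (Subgroup.center E : Set E)
    have hmap : (Subgroup.closure S).map θ = ⊤ := by
      rw [eq_top_iff, ← MonoidHom.range_eq_top.2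
        (QuotientGroup.mk'_surjective (Subgroup.center (Phi7One p))), MonoidHom.range_eq_map,
        ← PresentedGroup.closure_range_of, MonoidHom.map_closure, Subgroup.closure_le]
      have hS : ∀ s ∈ S, θ s ∈ (Subgroup.closure S).map θ := fun s hs =>
        Subgroup.mem_map_of_mem θ (Subgroup.subset_closure hs)
      rintro _ ⟨_, ⟨g, rfl⟩, rfl⟩
      cases g
      · exact (show θ a = q _ from ha) ▸ hS a (by simp [S])
      · exact (show θ b = q _ from hb) ▸ hS b (by simp [S])
      · exact (show θ c = q _ from hc') ▸ hS c (by simp [S])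
      · exact (show θ e = q _ from he') ▸
          hS e (Or.inr (Subgroup.mem_center_iff.2 fun x => (hez x).eq.symm))
      · exact (show θ d = q _ from hd) ▸ hS d (by simp [S])
    -- The kernel of `θ` is central, hence inside the closure, so generating the image of `θ`
    -- suffices.
    refine (Subgroup.eq_top_iff' _).2 fun x => ?_
    obtain ⟨s, hs, hsx⟩ : θ x ∈ (Subgroup.closure S).map θ := hmap ▸ Subgroup.mem_top _
    have h1 : x * s⁻¹ ∈ Subgroup.closure S := by
      refine Subgroup.subset_closure (Or.inr (Subgroup.mem_center_iff.2 fun y => ?_))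
      refine (hcentral _ 1 (fun _ => Commute.one_left _) ?_ y).eq.symm
      rw [map_mul, map_inv, hsx, mul_inv_cancel, map_one]
    simpa using mul_mem h1 hs

/-! ### Central extensions from 2-cocycles and a splitting criterion. -/

section Extension

variable {G D : Type*} [Group G] [AddCommGroup D]

/-- The group extension of `G` by `D` with trivial action, attached to a 2-cocycle `f`. -/
@[ext]
structure CocycleExtension {f : G × G → D}
    (hf : ∀ g h j : G, f (g * h, j) + f (g, h) = f (h, j) + f (g, h * j)) where
  /-- The component in `D`. -/
  left : D
  /-- The component in `G`. -/
  right : G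

namespace CocycleExtension

variable {f : G × G → D} {hf : ∀ g h j : G, f (g * h, j) + f (g, h) = f (h, j) + f (g, h * j)}

instance : Mul (CocycleExtension hf) :=
  ⟨fun x y => ⟨x.left + y.left + f (x.right, y.right), x.right * y.right⟩⟩

-- The cocycle is not assumed normalized, whence the shift by f (1, 1) here and in `incl`.
instance : One (CocycleExtension hf) := ⟨⟨-f (1, 1), 1⟩⟩

instance : Inv (CocycleExtension hf) :=
  ⟨fun x => ⟨-x.left - f (x.right⁻¹, x.right) - f (1, 1), x.right⁻¹⟩⟩

@[simp] theorem mul_left (x y : CocycleExtension hf) :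
    (x * y).left = x.left + y.left + f (x.right, y.right) := rfl

@[simp] theorem mul_right (x y : CocycleExtension hf) : (x * y).right = x.right * y.right := rfl

@[simp] theorem one_left : (1 : CocycleExtension hf).left = -f (1, 1) := rfl

@[simp] theorem one_right : (1 : CocycleExtension hf).right = 1 := rfl

@[simp] theorem inv_left (x : CocycleExtension hf) :
    x⁻¹.left = -x.left - f (x.right⁻¹, x.right) - f (1, 1) := rfl

@[simp] theorem inv_right (x : CocycleExtension hf) : x⁻¹.right = x.right⁻¹ := rfl

theorem map_one_fst (hf : ∀ g h j : G, f (g * h, j) + f (g, h) = f (h, j) + f (g, h * j)) (g : G) : f (1, g) = f (1, 1) := by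
  simpa using (hf 1 1 g).symm

instance : Group (CocycleExtension hf) :=
  Group.ofLeftAxioms
    (fun x y z => by
      ext
      · have := hf x.right y.right z.right
        simp only [mul_left, mul_right]
        calc _ = x.left + y.left + z.left +
              (f (x.right * y.right, z.right) + f (x.right, y.right)) := by abel
          _ = _ := by rw [this]; abel
      · simp [mul_assoc])
    (fun x => by
      ext
      · simp [map_one_fst hf]
      · simp)
    (fun x => by
      ext
      · simp only [mul_left, inv_left, inv_right, one_left]; abel
      · simp)

variable (hf) in
/-- The projection onto `G`. -/
@[simps]
def proj : CocycleExtension hf →* G where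
  toFun := right
  map_one' := rfl
  map_mul' _ _ := rfl

variable (hf) in
/-- The inclusion of `D`. -/
@[simps]
def incl : Multiplicative D →* CocycleExtension hf where
  toFun x := ⟨x.toAdd - f (1, 1), 1⟩
  map_one' := by ext <;> simp
  map_mul' x y := by
    ext
    · simp; abel
    · simp

theorem proj_surjective : Function.Surjective (proj hf) := fun g => ⟨⟨0, g⟩, rfl⟩

theorem mk_mul_mk (g h : G) : (⟨0, g⟩ * ⟨0, h⟩ : CocycleExtension hf) =
    incl hf (.ofAdd (f (g, h))) * ⟨0, g * h⟩ := by
  ext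
  · simp [map_one_fst hf]
  · simp

/-- If the extension has divisible kernel that meets the commutator subgroup trivially, then the
cocycle is a coboundary. -/
theorem exists_coboundary (hD : Module.Baer ℤ D)
    (h : ∀ x ∈ commutator (CocycleExtension hf), proj hf x = 1 → x = 1) :
    ∃ x : G → D, ∀ g h : G, x h - x (g * h) + x g = f (g, h) := by
  let j : D →+ Additive (Abelianization (CocycleExtension hf)) :=
    (Abelianization.of.comp (incl hf)).toAdditiveRight
  -- The kernel of D → E^ab is D ∩ [E, E].
  have hj : Function.Injective j := by
    rw [injective_iff_map_eq_zero]
    intro x hx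
    have h1 : incl hf (.ofAdd x) ∈ commutator (CocycleExtension hf) :=
      (QuotientGroup.eq_one_iff _).1 hx
    have h2 := congrArg left (h _ h1 rfl)
    simpa using h2
  -- Injectivity of D extends its identity map to E^ab, giving a homomorphism from `E` to D that
  -- retracts the kernel; its values on the section g ↦ (0, g) cobound f.
  obtain ⟨r, hr⟩ := hD.extension_property_addMonoidHom j hj (AddMonoidHom.id D)
  let s : CocycleExtension hf → D := fun x => r (.ofMul (Abelianization.of x))
  have hs : ∀ x y, s (x * y) = s x + s y := fun x y => by
    simp only [s, map_mul, ofMul_mul, map_add]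
  have hsi : ∀ x, s (incl hf (.ofAdd x)) = x := fun x => DFunLike.congr_fun hr x
  refine ⟨fun g => s ⟨0, g⟩, fun g h => ?_⟩
  have h1 := congrArg s (mk_mul_mk (hf := hf) g h)
  rw [hs, hs, hsi] at h1
  rw [sub_add_eq_add_sub, sub_eq_iff_eq_add, add_comm, h1]

/-- Commuting elements of `G` have commuting lifts if the cocycle is symmetric on them. -/
theorem commute_of_commute_proj (hsymm : ∀ g h : G, Commute g h → f (g, h) = f (h, g))
    (x y : CocycleExtension hf) (h : Commute (proj hf x) (proj hf y)) : Commute x y := by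
  refine CocycleExtension.ext ?_ h.eq
  rw [mul_left, mul_left, hsymm x.right y.right h, add_comm x.left]

end CocycleExtension

end Extension

/-! ### Classes that vanish on abelian subgroups. -/

section Cohomology

open groupCohomology

/-- On the abelian subgroup generated by g and h the cocycle is a coboundary, and coboundaries with
trivial action are symmetric on commuting pairs. -/
theorem symm_of_mem_bogomolovMultiplier {G : Type u} [Group G] (f : cocycles₂ (trivialQZ G))
    (hf : H2π (trivialQZ G) f ∈ bogomolovMultiplier G) {g h : G} (hgh : Commute g h) :
    f (g, h) = f (h, g) := by
  let A : Subgroup G := Subgroup.closure {g, h}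
  have hA : IsMulCommutative A := Subgroup.isMulCommutative_closure (by
    rintro x (rfl | rfl) y (rfl | rfl)
    exacts [rfl, hgh.eq, hgh.eq.symm, rfl])
  have h1 : resH2 A (H2π (trivialQZ G) f) = 0 :=
    (Submodule.mem_iInf _).1 ((Submodule.mem_iInf _).1 hf A) hA
  have h2 : H2π (trivialQZ A) (mapCocycles₂ (A := trivialQZ G) (B := trivialQZ A) A.subtype
      (CategoryTheory.CategoryStruct.id (trivialQZ A)) f) = 0 := by
    rw [← h1]
    exact (H2π_comp_map_apply (A := trivialQZ G) (B := trivialQZ A) A.subtype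
      (CategoryTheory.CategoryStruct.id (trivialQZ A)) f).symm
  rw [H2π_eq_zero_iff] at h2
  obtain ⟨x, hx⟩ := h2
  have hx' : ∀ u v : A, x v - x (u * v) + x u = f ((u : G), (v : G)) :=
    fun u v => congrFun hx (u, v)
  have e1 := hx' ⟨g, Subgroup.subset_closure (by simp)⟩ ⟨h, Subgroup.subset_closure (by simp)⟩
  have e2 := hx' ⟨h, Subgroup.subset_closure (by simp)⟩ ⟨g, Subgroup.subset_closure (by simp)⟩
  rw [← e1, ← e2, hA.is_comm.comm]
  abel

theorem baer_ulift_addCircle :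
    Module.Baer ℤ (ULift.{u} (AddCircle (1 : ℚ))) :=
  (Module.Baer.of_divisible (AddCircle (1 : ℚ))).of_equiv ULift.moduleEquiv.symm

end Cohomology

theorem proposition3p5 (p : ℕ) (hp : p.Prime) (hp3 : 3 < p) (G : Type u) [Group G]
    (hG : InFamilyPhi7 p G) : bogomolovMultiplier G = ⊥ := by
  refine (Submodule.eq_bot_iff _).2 fun x hx => ?_
  induction x using groupCohomology.H2_induction_on with
  | h f =>
    have hf : ∀ g h j : G, f (g * h, j) + f (g, h) = f (h, j) + f (g, h * j) :=
      (groupCohomology.mem_cocycles₂_iff _).1 f.2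
    have hcomm := CocycleExtension.commute_of_commute_proj (hf := hf)
      fun g h => symm_of_mem_bogomolovMultiplier f hx
    obtain ⟨a, b, c, d, e, hsys⟩ :=
      exists_isPhi7System hG.2 (CocycleExtension.proj hf) CocycleExtension.proj_surjective hcomm
    obtain ⟨x, hx⟩ := CocycleExtension.exists_coboundary baer_ulift_addCircle
      fun _ => hsys.eq_one_of_mem_commutator hp (by omega) (CocycleExtension.proj hf) hcomm
    rw [groupCohomology.H2π_eq_zero_iff]
    exact ⟨x, funext fun gh => hx gh.1 gh.2⟩
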